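/- Let $p$ be a prime number, $\mathbb{Z}_{(p)}$ the localization of $\mathbb{Z}$ at $(p)$, $n\ge 0$ an integer, $L=\mathbb{Z}_{(p)}[x_0^{\pm1},x_1^{\pm1},\dots,x_n^{\pm1}]$ and $T=\mathbb{Q}[x_1^{\pm1},\dots,x_n^{\pm1}]$. A semigroup means a submonoid $M\subseteq\mathbb{Z}^{n+1}$; it is called pointed if the real cone $\mathbb{R}_{\ge0}M$ contains no line. Let $e_0=(1,0,\dots,0)\in\mathbb{Z}^{n+1}$. For a semigroup $M$, let $\mathbb{Z}_{(p)}[M]\subseteq L$ be the $\mathbb{Z}_{(p)}$-subalgebra generated by the monomials $x_0^{t_0}x_1^{t_1}\cdots x_n^{t_n}$ with $(t_0,\dots,t_n)\in M$, and, if $e_0\in M$, let $\mathbb{Z}_{(p)}[\overline{M}]\subseteq T$ be the $\mathbb{Z}_{(p)}$-subalgebra generated by the $p$-monomials $p^{t_0}x_1^{t_1}\cdots x_n^{t_n}$ with $(t_0,\dots,t_n)\in M$. A pointed affine $p$-semigroup ring is a subalgebra of $T$ of the form $\mathbb{Z}_{(p)}[\overline{M}]$ with $M$ a finitely generated pointed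 semigroup containing $e_0$. Let $\phi:L\to T$ be the $\mathbb{Z}_{(p)}$-algebra map that evaluates $x_0$ at $p$ and fixes $x_1,\dots,x_n$. The normalization $\tilde{R}$ of a domain $R$ is its integral closure in its field of fractions. **Theorem.** 1. Let $R\subseteq T$ be a pointed affine $p$-semigroup ring. Then $\tilde{R}$ embeds in $T$ over $R$, and its image in $T$ is again a pointed affine $p$-semigroup ring. 2. Let $M\subseteq\mathbb{Z}^{n+1}$ be a finitely generated pointed semigroup containing $e_0$, and put $S=\mathbb{Z}_{(p)}[M]$ and $R=\mathbb{Z}_{(p)}[\overline{M}]$. Then $\tilde{S}$ embeds in $L$ over $S$, $\tilde{R}$ embeds in $T$ over $R$, and, with these identifications, $\phi$ restricts to a surjective ring homomorphism $\tilde{S}\to\tilde{R}$ whose kernel is the principal ideal $(x_0-p)\tilde{S}$. -/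

import Mathlib

open Function

/-- The ring `ℤ_(p)`, as the subring of `ℚ` of all fractions whose denominator is prime to `p`. -/
def ZLoc (p : ℕ) [hp : Fact p.Prime] : Subring ℚ where
  carrier := {q | ¬ p ∣ q.den}
  mul_mem' := fun {a b} ha hb h =>
    (hp.out.dvd_mul.1 (h.trans (Rat.mul_den_dvd a b))).elim ha hb
  one_mem' := by simpa using hp.out.one_lt.ne'
  add_mem' := fun {a b} ha hb h =>
    (hp.out.dvd_mul.1 (h.trans (Rat.add_den_dvd a b))).elim ha hb
  zero_mem' := by simpa using hp.out.one_lt.ne'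
  neg_mem' := fun {a} ha => by simpa using ha

instance ZLoc.isPrime_span (p : ℕ) [hp : Fact p.Prime] : (Ideal.span {(p : ℤ)}).IsPrime :=
  (Ideal.span_singleton_prime (by exact_mod_cast hp.out.ne_zero)).2
    (Nat.prime_iff_prime_int.1 hp.out)

/-- `ZLoc p` is the localization of `ℤ` at the prime ideal `(p)`. -/
theorem ZLoc.isLocalization (p : ℕ) [hp : Fact p.Prime] :
    IsLocalization.AtPrime (ZLoc p) (Ideal.span {(p : ℤ)}) := by
  have key : ∀ z : ℤ, z ∈ (Ideal.span {(p : ℤ)}).primeCompl ↔ ¬ (p : ℤ) ∣ z := fun z => by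
    rw [Ideal.mem_primeCompl_iff, Ideal.mem_span_singleton]
  refine (isLocalization_iff _ _).2 ⟨fun y => ?_, fun z => ?_, fun {x y} h => ?_⟩
  · have hy := (key _).1 y.2
    have hy0 : ((y : ℤ) : ℚ) ≠ 0 := fun h => hy (by simp [Int.cast_eq_zero.1 h])
    refine IsUnit.of_mul_eq_one ⟨((y : ℤ) : ℚ)⁻¹, fun h => hy ?_⟩ (Subtype.ext ?_)
    · rw [Rat.inv_intCast_den] at h
      split_ifs at h with h0
      · exact (hp.out.one_lt.ne' (Nat.dvd_one.1 h)).elim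
      · exact Int.natCast_dvd.2 h
    · simp [hy0]
  · refine ⟨(z.1.num, ⟨(z.1.den : ℤ), (key _).2 fun h => z.2 (Int.natCast_dvd_natCast.1 h)⟩),
      Subtype.ext ?_⟩
    simp [Rat.mul_den_eq_num]
  · refine ⟨1, ?_⟩
    have := congrArg Subtype.val h
    simp at this
    simp [this]

/-- The Laurent polynomial ring `A[x_i^{±1} : i < m]`; the monomial `x^t` with exponent vector
`t : Fin m → ℤ` is `AddMonoidAlgebra.single t 1`. -/
abbrev Laurent (A : Type) [CommRing A] (m : ℕ) : Type := AddMonoidAlgebra A (Fin m → ℤ)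

/-- The semigroup ring `A[M]`: the `A`-subalgebra of the Laurent polynomial ring generated by the
monomials with exponent vector in `M`. -/
noncomputable def semigroupRing (A : Type) [CommRing A] {m : ℕ} (M : AddSubmonoid (Fin m → ℤ)) :
    Subalgebra A (Laurent A m) :=
  Algebra.adjoin A ((fun t => AddMonoidAlgebra.single t (1 : A)) '' (M : Set (Fin m → ℤ)))

/-- The `p`-monomial `p^{t_0} x_1^{t_1} ⋯ x_n^{t_n}` in `ℚ[x_1^{±1}, …, x_n^{±1}]`. -/
noncomputable def pMonomial (p : ℕ) {n : ℕ} (t : Fin (n + 1) → ℤ) : Laurent ℚ n :=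
  AddMonoidAlgebra.single (Fin.tail t) ((p : ℚ) ^ t 0)

/-- The `p`-semigroup ring `ℤ_(p)[M̄]`: the `ℤ_(p)`-subalgebra of `ℚ[x_1^{±1}, …, x_n^{±1}]`
generated by the `p`-monomials with exponent vector in `M`. -/
noncomputable def pSemigroupRing (p : ℕ) [Fact p.Prime] {n : ℕ} (M : AddSubmonoid (Fin (n + 1) → ℤ)) :
    Subalgebra (ZLoc p) (Laurent ℚ n) :=
  Algebra.adjoin (ZLoc p) (pMonomial p '' (M : Set (Fin (n + 1) → ℤ)))

/-- The exponent vector `e_0 = (1, 0, …, 0)`. -/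
def e0 (n : ℕ) : Fin (n + 1) → ℤ := Pi.single 0 1

/-- `M` is pointed: the real cone `ℝ_{≥0} M` contains no line through the origin
(such cones are called salient in Mathlib). -/
def IsPointedSemigroup {m : ℕ} (M : AddSubmonoid (Fin m → ℤ)) : Prop :=
  (PointedCone.hull ℝ
    ((fun (t : Fin m → ℤ) (i : Fin m) => (t i : ℝ)) '' (M : Set (Fin m → ℤ)))
      : ConvexCone ℝ (Fin m → ℝ)).Salient

/-- `R` is a pointed affine `p`-semigroup ring: `R = ℤ_(p)[M̄]` for a finitely generated pointed
semigroup `M` containing `e_0`. -/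
def IsPointedAffinePSemigroupRing (p : ℕ) [Fact p.Prime] {n : ℕ}
    (R : Subalgebra (ZLoc p) (Laurent ℚ n)) : Prop :=
  ∃ M : AddSubmonoid (Fin (n + 1) → ℤ),
    e0 n ∈ M ∧ M.FG ∧ IsPointedSemigroup M ∧ R = pSemigroupRing p M

/-- The normalization of a domain: its integral closure in its field of fractions. -/
abbrev Normalization (R : Type) [CommRing R] : Subalgebra R (FractionRing R) :=
  integralClosure R (FractionRing R)

/-- The evaluation map `x_0 ↦ p` from `ℤ_(p)[x_0^{±1}, …, x_n^{±1}]` to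
`ℚ[x_1^{±1}, …, x_n^{±1}]`, sending the monomial `x^t` to the `p`-monomial with exponent `t`. -/
noncomputable def evalP (p : ℕ) [hp : Fact p.Prime] (n : ℕ) :
    Laurent (ZLoc p) (n + 1) →ₐ[ZLoc p] Laurent ℚ n :=
  AddMonoidAlgebra.lift (ZLoc p) (Laurent ℚ n) (Fin (n + 1) → ℤ)
    { toFun := fun t => pMonomial p t.toAdd
      map_one' := by
        rw [AddMonoidAlgebra.one_def]
        simp [pMonomial]
        rfl
      map_mul' := fun s t => by
        have h : (p : ℚ) ≠ 0 := by exact_mod_cast hp.out.ne_zero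
        simp only [pMonomial, AddMonoidAlgebra.single_mul_single, toAdd_mul, Pi.add_apply,
          zpow_add₀ h]
        rfl }

/-- The variable `x_0`, as an element of `A[M]` when `e_0 ∈ M`. -/
noncomputable def x0 (A : Type) [CommRing A] {n : ℕ} {M : AddSubmonoid (Fin (n + 1) → ℤ)}
    (h : e0 n ∈ M) : semigroupRing A M :=
  ⟨AddMonoidAlgebra.single (e0 n) 1, Algebra.subset_adjoin ⟨e0 n, h, rfl⟩⟩

/-!
Both normalizations are computed explicitly. For a semigroup `M`, let `M~` be its saturation: the
elements of the group generated by `M` that have a positive multiple in `M`. Then, inside the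
Laurent polynomial rings, the normalization of `ℤ_(p)[M]` is `ℤ_(p)[M~]`
(`range_eq_semigroupRing_saturation`) and that of `ℤ_(p)[M̄]` is the ring `ℤ_(p)[M̄~]` of
`p`-monomials with exponents in `M~` (`range_eq_pSemigroupRing_saturation`).

The Laurent polynomial rings are integrally closed, being localizations of polynomial rings over a
factorial ring, so the normalization of a subring `R` consists of the Laurent polynomials that are
integral over `R` and are fractions of elements of `R` (`exists_normalization_embedding`). Both
semigroup rings are graded by the exponents, and the integral closure of a graded subring is graded
(`isIntegral_homogeneousComponent`): the coaction of the grading group reduces this to the fact that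
the coefficients of an integral polynomial are integral. Hence only monomials `c x^t` matter. The
homogeneous part of an integral equation of such a monomial (`exists_coeff_equation`) shows that a
multiple of its exponent vector lies in `M`; for `p`-monomials the first coordinate of this vector
is the `p`-adic valuation of `c`, and the point is that some term of the equation has valuation at
most that of the leading one. Being a fraction of elements of `R` puts the exponent vector in the
group generated by `M`. Conversely, monomials with exponents in `M~` are integral fractions.

By Gordan's lemma `M~` is again finitely generated, and it spans the same cone as `M`, which gives
the first part. For the second, evaluation at `x_0 = p` maps the monomial generators of `ℤ_(p)[M~]`
onto those of `ℤ_(p)[M̄~]`, and its kernel is found by collecting, modulo `x_0 - p`, all terms with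
the same exponents of `x_1, …, x_n` in a single term (`exists_eq_mul_of_evalP_eq_zero`).
-/

/-! ### Laurent polynomials as a localization of polynomials -/

/-- The inclusion of the polynomial ring `A[x_i : i < m]` into the Laurent polynomial ring. -/
noncomputable def polyToLaurent (A : Type) [CommRing A] (m : ℕ) :
    MvPolynomial (Fin m) A →+* Laurent A m :=
  AddMonoidAlgebra.mapDomainRingHom A
    ({ toFun := fun s i => (s i : ℤ), map_zero' := by ext; simp, map_add' := by intros; ext; simp } :
      (Fin m →₀ ℕ) →+ (Fin m → ℤ))

theorem polyToLaurent_monomial (A : Type) [CommRing A] (m : ℕ) (s : Fin m →₀ ℕ) (a : A) :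
    polyToLaurent A m (MvPolynomial.monomial s a)
      = AddMonoidAlgebra.single (fun i => (s i : ℤ)) a := by
  simp [polyToLaurent, ← MvPolynomial.single_eq_monomial]

theorem natCast_exponent_injective (m : ℕ) :
    Injective (fun (s : Fin m →₀ ℕ) (i : Fin m) => (s i : ℤ)) := fun s t h => by
  ext i
  have := congrFun h i
  simpa using this

theorem polyToLaurent_injective (A : Type) [CommRing A] (m : ℕ) :
    Injective (polyToLaurent A m) :=
  AddMonoidAlgebra.mapDomain_injective (natCast_exponent_injective m)

theorem coeff_polyToLaurent (A : Type) [CommRing A] (m : ℕ) (f : MvPolynomial (Fin m) A)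
    (s : Fin m →₀ ℕ) :
    (polyToLaurent A m f).coeff (fun i => (s i : ℤ)) = MvPolynomial.coeff s f :=
  Finsupp.mapDomain_apply (natCast_exponent_injective m) _ _

/-- Denominators of Laurent polynomials can be cleared by a monomial. -/
theorem exists_monomial_mul_eq_polyToLaurent (A : Type) [CommRing A] (m : ℕ) (f : Laurent A m) :
    ∃ (s : Fin m →₀ ℕ) (g : MvPolynomial (Fin m) A),
      polyToLaurent A m (MvPolynomial.monomial s 1) * f = polyToLaurent A m g := by
  induction f using AddMonoidAlgebra.induction_linear with
  | zero => exact ⟨0, 0, by simp⟩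
  | add f₁ f₂ h₁ h₂ =>
    obtain ⟨s₁, g₁, e₁⟩ := h₁
    obtain ⟨s₂, g₂, e₂⟩ := h₂
    refine ⟨s₁ + s₂, MvPolynomial.monomial s₂ 1 * g₁ + MvPolynomial.monomial s₁ 1 * g₂, ?_⟩
    rw [map_add, map_mul, map_mul, ← e₁, ← e₂, ← one_mul (1 : A), ← MvPolynomial.monomial_mul,
      map_mul]
    simp only [one_mul]
    ring
  | single t a =>
    refine ⟨Finsupp.equivFunOnFinite.symm fun i => (t i).natAbs,
      MvPolynomial.monomial (Finsupp.equivFunOnFinite.symm fun i => ((t i).natAbs + t i).toNat) a,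
      ?_⟩
    rw [polyToLaurent_monomial, polyToLaurent_monomial, AddMonoidAlgebra.single_mul_single, one_mul]
    congr 1
    ext i
    simp only [Finsupp.equivFunOnFinite_symm_apply_apply, Pi.add_apply]
    omega

/-- The multiplicative set of monomials in `A[x_i : i < m]`. -/
noncomputable def monomialSubmonoid (A : Type) [CommRing A] (m : ℕ) :
    Submonoid (MvPolynomial (Fin m) A) :=
  MonoidHom.mrange (MvPolynomial.monomialOneHom A (Fin m))

theorem monomial_mem_monomialSubmonoid (A : Type) [CommRing A] (m : ℕ) (s : Fin m →₀ ℕ) :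
    MvPolynomial.monomial s 1 ∈ monomialSubmonoid A m := ⟨Multiplicative.ofAdd s, rfl⟩

theorem exists_eq_monomial_of_mem {A : Type} [CommRing A] {m : ℕ} {f : MvPolynomial (Fin m) A}
    (h : f ∈ monomialSubmonoid A m) : ∃ s, f = MvPolynomial.monomial s 1 := by
  obtain ⟨s, rfl⟩ := h
  exact ⟨s.toAdd, rfl⟩

theorem isUnit_single_one {A : Type} [CommRing A] {m : ℕ} (t : Fin m → ℤ) :
    IsUnit (AddMonoidAlgebra.single t 1 : Laurent A m) :=
  IsUnit.of_mul_eq_one (AddMonoidAlgebra.single (-t) 1) (by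
    simp [AddMonoidAlgebra.single_mul_single, AddMonoidAlgebra.one_def])

theorem isLocalization_laurent (A : Type) [CommRing A] (m : ℕ) :
    letI := (polyToLaurent A m).toAlgebra
    IsLocalization (monomialSubmonoid A m) (Laurent A m) := by
  let := (polyToLaurent A m).toAlgebra
  refine (isLocalization_iff _ _).2 ⟨fun y => ?_, fun f => ?_, fun {x y} h => ⟨1, ?_⟩⟩
  · obtain ⟨s, hs⟩ := exists_eq_monomial_of_mem y.2
    rw [RingHom.algebraMap_toAlgebra, hs, polyToLaurent_monomial]
    exact isUnit_single_one _
  · obtain ⟨s, g, h⟩ := exists_monomial_mul_eq_polyToLaurent A m f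
    exact ⟨(g, ⟨_, monomial_mem_monomialSubmonoid A m s⟩), by
      rw [mul_comm]; exact h⟩
  · rw [polyToLaurent_injective A m h]

instance laurent_isIntegrallyClosed (A : Type) [CommRing A] [IsDomain A] [UniqueFactorizationMonoid A]
    (m : ℕ) : IsIntegrallyClosed (Laurent A m) := by
  let := (polyToLaurent A m).toAlgebra
  have := isLocalization_laurent A m
  refine isIntegrallyClosed_of_isLocalization _ (monomialSubmonoid A m) fun f hf => ?_
  obtain ⟨s, rfl⟩ := exists_eq_monomial_of_mem hf
  exact mem_nonZeroDivisors_of_ne_zero (by simp)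

instance ZLoc.isDiscreteValuationRing (p : ℕ) [hp : Fact p.Prime] :
    IsDiscreteValuationRing (ZLoc p) :=
  have := ZLoc.isLocalization p
  IsLocalization.AtPrime.isDiscreteValuationRing_of_dedekind_domain ℤ
    (P := Ideal.span {(p : ℤ)}) (by simpa using hp.out.ne_zero) (ZLoc p)

/-! ### Integral closures of graded subrings -/

theorem coeff_polyToLaurent_eq_zero {A : Type} [CommRing A] {m : ℕ} (f : MvPolynomial (Fin m) A)
    {t : Fin m → ℤ} (h : t ∉ Set.range fun (s : Fin m →₀ ℕ) (i : Fin m) => (s i : ℤ)) :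
    (polyToLaurent A m f).coeff t = 0 :=
  Finsupp.mapDomain_of_notMem_range _ _ h

/-- A Laurent polynomial over `S` is integral over the Laurent polynomials over `R` only if its
coefficients are integral over `R`. This is reduced to polynomials by clearing denominators. -/
theorem isIntegralElem_coeff {R S : Type} [CommRing R] [CommRing S] (φ : R →+* S) {m : ℕ}
    {f : Laurent S m} (hf : (AddMonoidAlgebra.mapRingHom (Fin m → ℤ) φ).IsIntegralElem f)
    (t : Fin m → ℤ) : φ.IsIntegralElem (f.coeff t) := by
  set Φ := AddMonoidAlgebra.mapRingHom (Fin m → ℤ) φ with hΦ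
  have hcomm : Φ.comp (polyToLaurent R m) = (polyToLaurent S m).comp (MvPolynomial.map φ) := by
    refine RingHom.ext fun g => ?_
    induction g using MvPolynomial.induction_on' with
    | monomial s a => simp [hΦ, polyToLaurent_monomial]
    | add g₁ g₂ h₁ h₂ => rw [map_add, map_add, h₁, h₂]
  -- Clear denominators in the equation of integrality, then in `f`.
  obtain ⟨s, hs⟩ : ∃ s : Fin m →₀ ℕ, (Φ.comp (polyToLaurent R m)).IsIntegralElem
      (polyToLaurent S m (MvPolynomial.monomial s 1) * f) := by
    let := (polyToLaurent R m).toAlgebra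
    let : Algebra (Laurent R m) (Laurent S m) := Φ.toAlgebra
    let : Algebra (MvPolynomial (Fin m) R) (Laurent S m) :=
      (Φ.comp (polyToLaurent R m)).toAlgebra
    have : IsScalarTower (MvPolynomial (Fin m) R) (Laurent R m) (Laurent S m) :=
      IsScalarTower.of_algebraMap_eq' rfl
    have := isLocalization_laurent R m
    obtain ⟨⟨u, hu⟩, h⟩ := IsIntegral.exists_multiple_integral_of_isLocalization
      (Rₘ := Laurent R m) (monomialSubmonoid R m) f hf
    obtain ⟨s, rfl⟩ := exists_eq_monomial_of_mem hu
    refine ⟨s, ?_⟩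
    rw [Submonoid.smul_def, Algebra.smul_def] at h
    have e : Φ (polyToLaurent R m (MvPolynomial.monomial s 1))
        = polyToLaurent S m (MvPolynomial.monomial s 1) := by
      simp [hΦ, polyToLaurent_monomial]
    rw [← e]
    exact h
  obtain ⟨s', g, hg⟩ := exists_monomial_mul_eq_polyToLaurent S m
    (polyToLaurent S m (MvPolynomial.monomial s 1) * f)
  have hint : (MvPolynomial.map φ).IsIntegralElem g := by
    refine RingHom.IsIntegralElem.of_map (polyToLaurent_injective S m) ?_
    rw [← hg, ← hcomm]
    refine RingHom.IsIntegralElem.mul _ ?_ hs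
    rw [show polyToLaurent S m (MvPolynomial.monomial s' 1)
      = (Φ.comp (polyToLaurent R m)) (MvPolynomial.monomial s' 1) by simp [hcomm]]
    exact RingHom.isIntegralElem_map _
  have hcoeff : f.coeff t =
      (polyToLaurent S m g).coeff ((fun i => (s' i : ℤ)) + ((fun i => (s i : ℤ)) + t)) := by
    rw [← hg, polyToLaurent_monomial, polyToLaurent_monomial,
      AddMonoidAlgebra.coeff_single_mul_add, AddMonoidAlgebra.coeff_single_mul_add, one_mul, one_mul]
  rw [hcoeff]
  by_cases h : (fun i => (s' i : ℤ)) + ((fun i => (s i : ℤ)) + t)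
      ∈ Set.range fun (s : Fin m →₀ ℕ) (i : Fin m) => (s i : ℤ)
  · obtain ⟨v, hv⟩ := h
    rw [← hv, coeff_polyToLaurent]
    let := φ.toAlgebra
    let := MvPolynomial.algebraMvPolynomial (σ := Fin m) (R := R) (S := S)
    exact MvPolynomial.isIntegral_iff_isIntegral_coeff.1 (show IsIntegral _ g from hint) v
  · rw [coeff_polyToLaurent_eq_zero g h]
    exact φ.isIntegralElem_zero

/-- The coaction `K[ℤ^m] → K[ℤ^m][ℤ^m]` of the grading group, which sends a monomial `c x^t` to
`(c x^t) y^t`. -/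
noncomputable def gradingCoaction (K : Type) [CommRing K] (m : ℕ) :
    Laurent K m →ₐ[K] Laurent (Laurent K m) m :=
  AddMonoidAlgebra.lift K (Laurent (Laurent K m) m) (Fin m → ℤ)
    { toFun := fun t => AddMonoidAlgebra.single t.toAdd (AddMonoidAlgebra.single t.toAdd 1)
      map_one' := by simp [AddMonoidAlgebra.one_def]
      map_mul' := fun s t => by
        simp [AddMonoidAlgebra.single_mul_single] }

theorem gradingCoaction_single {K : Type} [CommRing K] {m : ℕ} (t : Fin m → ℤ) (c : K) :
    gradingCoaction K m (AddMonoidAlgebra.single t c)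
      = AddMonoidAlgebra.single t (AddMonoidAlgebra.single t c) := by
  simp [gradingCoaction, AddMonoidAlgebra.lift_single, AddMonoidAlgebra.smul_single]

theorem coeff_gradingCoaction {K : Type} [CommRing K] {m : ℕ} (f : Laurent K m) (t : Fin m → ℤ) :
    (gradingCoaction K m f).coeff t = AddMonoidAlgebra.single t (f.coeff t) := by
  classical
  induction f using AddMonoidAlgebra.induction_linear with
  | zero => simp
  | add f₁ f₂ h₁ h₂ => simp [h₁, h₂, AddMonoidAlgebra.single_add]
  | single s c =>
    rw [gradingCoaction_single, AddMonoidAlgebra.coeff_single, AddMonoidAlgebra.coeff_single,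
      Finsupp.single_apply, Finsupp.single_apply]
    split_ifs with h
    · rw [h]
    · simp

/-- The integral closure of a graded subring is graded: if a subring `R` of a Laurent polynomial
ring contains the homogeneous components of its elements, then the homogeneous components of an
element integral over `R` are integral over `R`. -/
theorem isIntegral_homogeneousComponent {A K : Type} [CommRing A] [CommRing K] [Algebra A K] {m : ℕ}
    (R : Subalgebra A (Laurent K m))
    (hR : ∀ f ∈ R, ∀ t, AddMonoidAlgebra.single t (f.coeff t) ∈ R)
    {f : Laurent K m} (hf : IsIntegral R f) (t : Fin m → ℤ) :
    IsIntegral R (AddMonoidAlgebra.single t (f.coeff t) : Laurent K m) := by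
  set Φ := AddMonoidAlgebra.mapRingHom (Fin m → ℤ) (algebraMap R (Laurent K m)) with hΦ
  have hΦi : Injective Φ :=
    AddMonoidAlgebra.map_injective _ Subtype.val_injective
  have hrange (r : R) : ∃ x, Φ x = gradingCoaction K m r := by
    change gradingCoaction K m r ∈ Set.range (AddMonoidAlgebra.map _)
    rw [AddMonoidAlgebra.range_map]
    intro t
    rw [coeff_gradingCoaction]
    exact ⟨⟨_, hR r r.2 t⟩, rfl⟩
  choose d hd using hrange
  let D : R →+* Laurent R m :=
    { toFun := d
      map_one' := hΦi (by simp [hd])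
      map_mul' := fun _ _ => hΦi (by simp [hd])
      map_zero' := hΦi (by simp [hd])
      map_add' := fun _ _ => hΦi (by simp [hd]) }
  have hD : Φ.comp D = (gradingCoaction K m).toRingHom.comp (algebraMap R (Laurent K m)) :=
    RingHom.ext hd
  have h := RingHom.IsIntegralElem.map hf (gradingCoaction K m).toRingHom
  rw [← hD] at h
  have := isIntegralElem_coeff _ h.of_comp t
  rwa [AlgHom.toRingHom_eq_coe, RingHom.coe_coe, coeff_gradingCoaction] at this

/-! ### Normalizations inside an integrally closed overring -/

/-- The normalization of a subalgebra `R` of an integrally closed domain `T` embeds in `T`, as the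
set of the fractions of elements of `R` that are integral over `R`. -/
theorem exists_normalization_embedding {A T : Type} [CommRing A] [CommRing T] [IsDomain T]
    [IsIntegrallyClosed T] [Algebra A T] (R : Subalgebra A T) :
    ∃ j : Normalization R →ₐ[R] T, Injective j ∧
      ∀ f, f ∈ j.range ↔ IsIntegral R f ∧ ∃ a ∈ R, ∃ b ∈ R, b ≠ 0 ∧ b * f = a := by
  have hTL : Injective (algebraMap T (FractionRing T)) := IsFractionRing.injective T _
  have hRL : Injective (algebraMap R (FractionRing T)) := by
    rw [IsScalarTower.algebraMap_eq R T (FractionRing T)]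
    exact hTL.comp Subtype.val_injective
  have : FaithfulSMul R (FractionRing T) := (faithfulSMul_iff_algebraMap_injective _ _).2 hRL
  let κ : FractionRing R →ₐ[R] FractionRing T :=
    IsFractionRing.liftAlgHom (g := Algebra.ofId R (FractionRing T)) hRL
  let ι : T →ₐ[R] FractionRing T := IsScalarTower.toAlgHom R T (FractionRing T)
  have hκ : Injective κ := κ.toRingHom.injective
  have hι : Injective ι := hTL
  have hmem (z : Normalization R) : (κ.comp (Normalization R).val) z ∈ ι.range := by
    have hz : IsIntegral T (κ z.1) := (z.2.map κ).tower_top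
    obtain ⟨y, hy⟩ := IsIntegrallyClosed.isIntegral_iff.1 hz
    exact ⟨y, hy⟩
  let j : Normalization R →ₐ[R] T := ((AlgEquiv.ofInjective ι hι).symm : ι.range →ₐ[R] T).comp
    ((κ.comp (Normalization R).val).codRestrict ι.range hmem)
  have hj (z : Normalization R) : ι (j z) = κ z.1 := by
    have := AlgEquiv.apply_symm_apply (AlgEquiv.ofInjective ι hι) ⟨_, hmem z⟩
    exact congrArg Subtype.val this
  refine ⟨j, fun x y h => Subtype.ext (hκ ?_), fun f => ⟨?_, ?_⟩⟩
  · rw [← hj, ← hj, h]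
  · rintro ⟨z, rfl⟩
    refine ⟨IsIntegral.map j ((isIntegral_algHom_iff (Normalization R).val
      Subtype.val_injective).1 z.2), ?_⟩
    obtain ⟨a, b, hb, e⟩ := IsFractionRing.div_surjective (A := R) z.1
    have hb0 : b ≠ 0 := nonZeroDivisors.ne_zero hb
    refine ⟨a, a.2, b, b.2, fun h => hb0 (Subtype.ext h), hι ?_⟩
    have hb' : algebraMap R (FractionRing R) b ≠ 0 := by
      simpa using hb0
    rw [map_mul]
    change ι b * ι (j z) = _
    rw [hj, ← e]
    have h1 : ι b = κ (algebraMap R _ b) := (κ.commutes b).symm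
    have h2 : ι a = κ (algebraMap R _ a) := (κ.commutes a).symm
    rw [h1, h2, ← map_mul, mul_div_cancel₀ _ hb']
  · rintro ⟨hf, a, ha, b, hb, hb0, e⟩
    have hb' : algebraMap R (FractionRing R) ⟨b, hb⟩ ≠ 0 := by
      simpa [Subtype.ext_iff] using hb0
    have key : κ (algebraMap R _ ⟨a, ha⟩ / algebraMap R _ ⟨b, hb⟩) = ι f := by
      rw [map_div₀, div_eq_iff ((map_ne_zero κ).2 hb'), κ.commutes, κ.commutes, ← ι.commutes,
        ← ι.commutes, ← map_mul, mul_comm]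
      exact congrArg ι e.symm
    refine ⟨⟨_, (isIntegral_algHom_iff κ hκ).1 (key ▸ hf.map ι)⟩, hι ?_⟩
    exact (hj _).trans key

/-! ### Subalgebras cut out by conditions on coefficients -/

/-- The graded subalgebra of the Laurent polynomial ring whose component in degree `t` is
`F t`. -/
def coeffSubalgebra {A K : Type} [CommRing A] [CommRing K] [Algebra A K] {m : ℕ}
    (F : (Fin m → ℤ) → AddSubgroup K) (halg : ∀ a : A, algebraMap A K a ∈ F 0)
    (hmul : ∀ s t a b, a ∈ F s → b ∈ F t → a * b ∈ F (s + t)) :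
    Subalgebra A (Laurent K m) where
  carrier := {f | ∀ t, f.coeff t ∈ F t}
  add_mem' hf hg t := add_mem (hf t) (hg t)
  mul_mem' {f g} hf hg t := by
    classical
    rw [AddMonoidAlgebra.coeff_mul]
    refine sum_mem fun u _ => sum_mem fun v _ => ?_
    dsimp only
    split_ifs with h
    · exact h ▸ hmul _ _ _ _ (hf u) (hg v)
    · exact zero_mem _
  algebraMap_mem' a t := by
    classical
    rw [AddMonoidAlgebra.coe_algebraMap, comp_apply, AddMonoidAlgebra.coeff_single,
      Finsupp.single_apply]
    split_ifs with h
    · exact h ▸ halg a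
    · exact zero_mem _

theorem single_mem_coeffSubalgebra {A K : Type} [CommRing A] [CommRing K] [Algebra A K] {m : ℕ}
    {F : (Fin m → ℤ) → AddSubgroup K} {halg : ∀ a : A, algebraMap A K a ∈ F 0}
    {hmul : ∀ s t a b, a ∈ F s → b ∈ F t → a * b ∈ F (s + t)} {t : Fin m → ℤ} {c : K}
    (hc : c ∈ F t) : AddMonoidAlgebra.single t c ∈ coeffSubalgebra F halg hmul := fun s => by
  classical
  rw [AddMonoidAlgebra.coeff_single, Finsupp.single_apply]
  split_ifs with h
  · exact h ▸ hc
  · exact zero_mem _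

theorem mem_of_forall_single_mem {A K : Type} [CommRing A] [CommRing K] [Algebra A K] {m : ℕ}
    {R : Subalgebra A (Laurent K m)} {f : Laurent K m}
    (h : ∀ t, AddMonoidAlgebra.single t (f.coeff t) ∈ R) : f ∈ R := by
  rw [← AddMonoidAlgebra.sum_coeff_single f]
  exact sum_mem fun t _ => h t

theorem mem_semigroupRing_iff {A : Type} [CommRing A] {m : ℕ} {M : AddSubmonoid (Fin m → ℤ)}
    {f : Laurent A m} : f ∈ semigroupRing A M ↔ ∀ t, f.coeff t ≠ 0 → t ∈ M := by
  constructor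
  · let F (t : Fin m → ℤ) : AddSubgroup A :=
      { carrier := {c | c ≠ 0 → t ∈ M}
        zero_mem' := fun h => absurd rfl h
        add_mem' := fun {a b} ha hb h => by
          by_cases ha0 : a = 0
          · exact hb fun hb0 => h (by rw [ha0, hb0, add_zero])
          · exact ha ha0
        neg_mem' := fun {a} ha h => ha (neg_ne_zero.1 h) }
    have hle : semigroupRing A M ≤ coeffSubalgebra F (fun _ _ => zero_mem M)
        (fun s t a b ha hb h => add_mem (ha (left_ne_zero_of_mul h)) (hb (right_ne_zero_of_mul h))) := by
      refine Algebra.adjoin_le ?_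
      rintro _ ⟨t, ht, rfl⟩
      exact single_mem_coeffSubalgebra fun _ => ht
    exact fun hf => hle hf
  · refine fun h => mem_of_forall_single_mem fun t => ?_
    by_cases h0 : f.coeff t = 0
    · rw [h0, AddMonoidAlgebra.single_zero]
      exact zero_mem _
    · rw [← mul_one (f.coeff t), ← smul_eq_mul, ← AddMonoidAlgebra.smul_single]
      exact Subalgebra.smul_mem _ (Algebra.subset_adjoin (Set.mem_image_of_mem _ (h t h0))) _

/-! ### The `p`-adic valuation and `p`-monomials -/

theorem padicValRat_nonneg_of_mem_ZLoc {p : ℕ} [Fact p.Prime] {q : ℚ} (hq : q ∈ ZLoc p) :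
    0 ≤ padicValRat p q := by
  have : padicValNat p q.den = 0 := padicValNat.eq_zero_of_not_dvd hq
  rw [padicValRat_def, this]
  simp

theorem mem_ZLoc_of_padicValRat_nonneg {p : ℕ} [hp : Fact p.Prime] {q : ℚ}
    (hq : 0 ≤ padicValRat p q) : q ∈ ZLoc p := by
  intro h
  have h1 : 1 ≤ padicValNat p q.den := one_le_padicValNat_of_dvd q.den_nz h
  have h2 : padicValInt p q.num = 0 := by
    refine padicValInt.eq_zero_of_not_dvd fun h' => ?_
    exact Nat.not_coprime_of_dvd_of_dvd hp.out.one_lt (Int.natCast_dvd.1 h') h q.reduced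
  rw [padicValRat_def, h2] at hq
  omega

theorem pMonomial_add (p : ℕ) [hp : Fact p.Prime] {n : ℕ} (s t : Fin (n + 1) → ℤ) :
    pMonomial p (s + t) = pMonomial p s * pMonomial p t := by
  have h : (p : ℚ) ≠ 0 := by exact_mod_cast hp.out.ne_zero
  simp only [pMonomial, AddMonoidAlgebra.single_mul_single, Pi.add_apply, zpow_add₀ h]
  rfl

theorem pMonomial_zero (p : ℕ) {n : ℕ} : pMonomial p (0 : Fin (n + 1) → ℤ) = 1 := by
  simp [pMonomial, AddMonoidAlgebra.one_def]
  rfl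

theorem pMonomial_nsmul (p : ℕ) [hp : Fact p.Prime] {n : ℕ} (k : ℕ) (t : Fin (n + 1) → ℤ) :
    pMonomial p (k • t) = pMonomial p t ^ k := by
  induction k with
  | zero => simp [pMonomial_zero]
  | succ k ih => rw [succ_nsmul, pMonomial_add, ih, pow_succ]

theorem pMonomial_ne_zero (p : ℕ) [hp : Fact p.Prime] {n : ℕ} (t : Fin (n + 1) → ℤ) :
    pMonomial p t ≠ 0 := by
  have h : (p : ℚ) ≠ 0 := by exact_mod_cast hp.out.ne_zero
  simp [pMonomial, zpow_ne_zero _ h]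

theorem cons_add_nsmul_e0 {n : ℕ} (a : ℤ) (g : Fin n → ℤ) (k : ℕ) :
    (Fin.cons a g : Fin (n + 1) → ℤ) + k • e0 n = Fin.cons (a + k) g := by
  ext i
  refine Fin.cases ?_ (fun i => ?_) i <;> simp [e0]

theorem cons_mem_of_le {n : ℕ} {M : AddSubmonoid (Fin (n + 1) → ℤ)} (he : e0 n ∈ M) {a b : ℤ}
    {g : Fin n → ℤ} (hab : a ≤ b) (h : (Fin.cons a g : Fin (n + 1) → ℤ) ∈ M) :
    (Fin.cons b g : Fin (n + 1) → ℤ) ∈ M := by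
  have := add_mem h (nsmul_mem he (b - a).toNat)
  rwa [cons_add_nsmul_e0, Int.toNat_of_nonneg (by omega), add_sub_cancel] at this

/-- A Laurent polynomial lies in `ℤ_(p)[M̄]` if and only if, for each of its terms `c x^g`, the
exponent vector `(v_p(c), g)` lies in `M`. -/
theorem mem_pSemigroupRing_iff {p : ℕ} [hp : Fact p.Prime] {n : ℕ}
    {M : AddSubmonoid (Fin (n + 1) → ℤ)} (he : e0 n ∈ M) {f : Laurent ℚ n} :
    f ∈ pSemigroupRing p M ↔
      ∀ g, f.coeff g ≠ 0 → (Fin.cons (padicValRat p (f.coeff g)) g : Fin (n + 1) → ℤ) ∈ M := by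
  have hp0 : (p : ℚ) ≠ 0 := by exact_mod_cast hp.out.ne_zero
  have hpow (a : ℤ) : padicValRat p ((p : ℚ) ^ a) = a := by
    rw [padicValRat.zpow, padicValRat.self hp.out.one_lt, mul_one]
  constructor
  · let F (g : Fin n → ℤ) : AddSubgroup ℚ :=
      { carrier := {c | c ≠ 0 → (Fin.cons (padicValRat p c) g : Fin (n + 1) → ℤ) ∈ M}
        zero_mem' := fun h => absurd rfl h
        add_mem' := fun {a b} ha hb h => by
          by_cases ha0 : a = 0
          · subst ha0
            rw [zero_add] at h ⊢
            exact hb h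
          by_cases hb0 : b = 0
          · subst hb0
            rw [add_zero] at h ⊢
            exact ha h
          rcases min_le_iff.1 (padicValRat.min_le_padicValRat_add (p := p) h) with h' | h'
          · exact cons_mem_of_le he h' (ha ha0)
          · exact cons_mem_of_le he h' (hb hb0)
        neg_mem' := fun {a} ha h => by
          rw [padicValRat.neg]
          exact ha (neg_ne_zero.1 h) }
    have halg (a : ZLoc p) : algebraMap (ZLoc p) ℚ a ∈ F 0 := fun _ => by
      refine cons_mem_of_le he (padicValRat_nonneg_of_mem_ZLoc a.2) ?_
      convert zero_mem M
      ext i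
      refine Fin.cases ?_ (fun i => ?_) i <;> simp
    have hmul (s t : Fin n → ℤ) (a b : ℚ) (ha : a ∈ F s) (hb : b ∈ F t) : a * b ∈ F (s + t) :=
      fun h => by
        have ha0 := left_ne_zero_of_mul h
        have hb0 := right_ne_zero_of_mul h
        rw [padicValRat.mul ha0 hb0]
        convert add_mem (ha ha0) (hb hb0)
        ext i
        refine Fin.cases ?_ (fun i => ?_) i <;> simp
    have hle : pSemigroupRing p M ≤ coeffSubalgebra F halg hmul := by
      refine Algebra.adjoin_le ?_
      rintro _ ⟨t, ht, rfl⟩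
      refine single_mem_coeffSubalgebra fun _ => ?_
      rwa [hpow, Fin.cons_self_tail]
    exact fun hf => hle hf
  · refine fun h => mem_of_forall_single_mem fun g => ?_
    by_cases h0 : f.coeff g = 0
    · rw [h0, AddMonoidAlgebra.single_zero]
      exact zero_mem _
    -- Write the coefficient as a unit of `ℤ_(p)` times a power of `p`.
    set c := f.coeff g
    have hu : c * (p : ℚ) ^ (-padicValRat p c) ∈ ZLoc p := by
      refine mem_ZLoc_of_padicValRat_nonneg ?_
      rw [padicValRat.mul h0 (zpow_ne_zero _ hp0), hpow, add_neg_cancel]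
    have : AddMonoidAlgebra.single g c = (⟨_, hu⟩ : ZLoc p) •
        pMonomial p (Fin.cons (padicValRat p c) g : Fin (n + 1) → ℤ) := by
      rw [pMonomial, AddMonoidAlgebra.smul_single, Fin.tail_cons, Fin.cons_zero]
      congr 1
      rw [Subring.smul_def, smul_eq_mul, mul_assoc, ← zpow_add₀ hp0, neg_add_cancel, zpow_zero,
        mul_one]
    rw [this]
    exact Subalgebra.smul_mem _ (Algebra.subset_adjoin (Set.mem_image_of_mem _ (h g h0))) _

/-! ### Saturation of a semigroup -/

/-- The normalization of a semigroup `M`: the elements of the group generated by `M` that have a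
positive multiple in `M`. -/
def saturation {m : ℕ} (M : AddSubmonoid (Fin m → ℤ)) : AddSubmonoid (Fin m → ℤ) where
  carrier := {t | t ∈ AddSubgroup.closure (M : Set (Fin m → ℤ)) ∧ ∃ k : ℕ, 0 < k ∧ k • t ∈ M}
  zero_mem' := ⟨zero_mem _, 1, one_pos, by simp⟩
  add_mem' := by
    rintro s t ⟨hs, k, hk, hks⟩ ⟨ht, l, hl, hlt⟩
    refine ⟨add_mem hs ht, k * l, Nat.mul_pos hk hl, ?_⟩
    rw [nsmul_add, mul_nsmul, mul_comm, mul_nsmul t l k]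
    exact add_mem (nsmul_mem hks l) (nsmul_mem hlt k)

theorem le_saturation {m : ℕ} (M : AddSubmonoid (Fin m → ℤ)) : M ≤ saturation M := fun t ht =>
  ⟨AddSubgroup.subset_closure ht, 1, one_pos, by simpa⟩

/-- A version of Gordan's lemma. -/
theorem saturation_fg {m : ℕ} {M : AddSubmonoid (Fin m → ℤ)} (hM : M.FG) : (saturation M).FG := by
  obtain ⟨S, rfl⟩ := hM
  set M := AddSubmonoid.closure (S : Set (Fin m → ℤ)) with hMdef
  have hS : ∀ v ∈ S, v ∈ M := fun v hv => AddSubmonoid.subset_closure hv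
  let B : Fin m → ℤ := fun i => ∑ v ∈ S, |v i|
  let box : Set (Fin m → ℤ) := Set.Icc (-B) B ∩ saturation M
  refine (AddSubmonoid.fg_iff _).2 ⟨S ∪ box, le_antisymm (AddSubmonoid.closure_le.2 ?_) ?_,
    S.finite_toSet.union ((Set.finite_Icc _ _).subset Set.inter_subset_left)⟩
  · exact Set.union_subset (fun v hv => le_saturation M (hS v hv)) Set.inter_subset_right
  -- Split off the integral parts of the coefficients of `t` in the generators; the remainder
  -- lies in the box.
  rintro t ⟨ht, k, hk, hkt⟩
  obtain ⟨a, -, ha⟩ := AddSubmonoid.mem_closure_finset.1 hkt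
  set s := t - ∑ v ∈ S, (a v / k) • v with hs
  have hks : k • s = ∑ v ∈ S, (a v % k) • v := by
    rw [hs, nsmul_sub, ← ha, Finset.smul_sum, ← Finset.sum_sub_distrib]
    refine Finset.sum_congr rfl fun v _ => ?_
    rw [sub_eq_iff_eq_add, ← mul_nsmul', ← add_nsmul, Nat.mod_add_div]
  have hsmem : s ∈ saturation M := by
    refine ⟨sub_mem ht (sum_mem fun v hv => ?_), k, hk, ?_⟩
    · exact nsmul_mem (AddSubgroup.subset_closure (hS v hv)) _
    · rw [hks]
      exact sum_mem fun v hv => nsmul_mem (hS v hv) _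
  have hbound (i : Fin m) : |s i| ≤ B i := by
    have hk' : (0 : ℤ) < k := by exact_mod_cast hk
    refine le_of_mul_le_mul_left ?_ hk'
    have h1 : (k : ℤ) * s i = ∑ v ∈ S, ((a v % k : ℕ) : ℤ) * v i := by
      have := congrFun hks i
      simpa using this
    rw [← abs_of_pos hk', ← abs_mul, h1, abs_of_pos hk', Finset.mul_sum]
    refine (Finset.abs_sum_le_sum_abs _ _).trans (Finset.sum_le_sum fun v _ => ?_)
    rw [abs_mul, Nat.abs_cast]
    exact mul_le_mul_of_nonneg_right (by exact_mod_cast (Nat.mod_lt _ hk).le) (abs_nonneg _)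
  have : t = s + ∑ v ∈ S, (a v / k) • v := by rw [hs, sub_add_cancel]
  rw [this]
  refine add_mem (AddSubmonoid.subset_closure (Set.mem_union_right _ ⟨⟨fun i => ?_, fun i => ?_⟩, hsmem⟩))
    (sum_mem fun v hv => nsmul_mem (AddSubmonoid.subset_closure (Set.mem_union_left _ hv)) _)
  · exact (abs_le.1 (hbound i)).1
  · exact (abs_le.1 (hbound i)).2

theorem isPointedSemigroup_saturation {m : ℕ} {M : AddSubmonoid (Fin m → ℤ)}
    (hM : IsPointedSemigroup M) : IsPointedSemigroup (saturation M) := by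
  refine ConvexCone.Salient.anti ?_ hM
  refine Submodule.span_le.2 ?_
  rintro _ ⟨t, ⟨-, k, hk, hkt⟩, rfl⟩
  have hmem := (PointedCone.hull ℝ
    ((fun (t : Fin m → ℤ) (i : Fin m) => (t i : ℝ)) '' (M : Set (Fin m → ℤ)))).smul_mem
    (show (0 : ℝ) ≤ (k : ℝ)⁻¹ by positivity) (Submodule.subset_span ⟨_, hkt, rfl⟩)
  have hk0 : (k : ℝ) ≠ 0 := by exact_mod_cast hk.ne'
  have ht : (fun i => (t i : ℝ)) = (k : ℝ)⁻¹ • fun i => (((k • t) i : ℤ) : ℝ) := by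
    ext i
    simp [hk0]
  rw [SetLike.mem_coe]
  beta_reduce
  rw [ht]
  exact hmem

theorem exists_add_eq_of_mem_closure {G : Type} [AddCommGroup G] {M : AddSubmonoid G} {t : G}
    (ht : t ∈ AddSubgroup.closure (M : Set G)) : ∃ u ∈ M, ∃ v ∈ M, v + t = u := by
  induction ht using AddSubgroup.closure_induction with
  | mem x hx => exact ⟨x, hx, 0, zero_mem _, zero_add x⟩
  | zero => exact ⟨0, zero_mem _, 0, zero_mem _, zero_add 0⟩
  | add x y _ _ hx hy =>
    obtain ⟨u, hu, v, hv, e⟩ := hx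
    obtain ⟨u', hu', v', hv', e'⟩ := hy
    refine ⟨u + u', add_mem hu hu', v + v', add_mem hv hv', ?_⟩
    rw [← e, ← e']
    abel
  | neg x _ hx =>
    obtain ⟨u, hu, v, hv, e⟩ := hx
    exact ⟨v, hv, u, hu, by rw [← e]; abel⟩

/-! ### Integral closures of semigroup rings -/

/-- If a product and one of its factors, which is nonzero, are supported in a subgroup `G`, then so
is the other factor. -/
theorem mem_of_mul_eq {K : Type} [CommRing K] [IsDomain K] {m : ℕ} (G : AddSubgroup (Fin m → ℤ))
    {a b f : Laurent K m} (ha : ∀ t, a.coeff t ≠ 0 → t ∈ G) (hb : ∀ t, b.coeff t ≠ 0 → t ∈ G)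
    (hb0 : b ≠ 0) (h : b * f = a) {t : Fin m → ℤ} (ht : f.coeff t ≠ 0) : t ∈ G := by
  classical
  -- The part of `f` supported off `G` is annihilated by `b`.
  let f₁ : Laurent K m := .ofCoeff (f.coeff.filter (· ∈ G))
  let f₂ : Laurent K m := .ofCoeff (f.coeff.filter (· ∉ G))
  have hf : f₁ + f₂ = f := by
    have := Finsupp.filter_add_filter_not f.coeff (· ∈ G)
    exact congrArg AddMonoidAlgebra.ofCoeff this
  have hsum : b * f₁ + b * f₂ = a := by rw [← mul_add, hf, h]
  have h0 : b * f₂ = 0 := by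
    ext s
    by_cases hs : s ∈ G
    · rw [AddMonoidAlgebra.coeff_mul]
      refine Finset.sum_eq_zero fun u hu => Finset.sum_eq_zero fun v hv => if_neg fun e => ?_
      have hu' : u ∈ G := hb u (Finsupp.mem_support_iff.1 hu)
      have hv' : v ∉ G := ((Finsupp.mem_support_iff.1 hv) <| Finsupp.filter_apply_neg _ _ <| not_not.2 ·)
      exact hv' (by rw [← add_sub_cancel_left u v, e]; exact sub_mem hs hu')
    · have ha' : a.coeff s = 0 := not_not.1 fun h => hs (ha s h)
      have h1 : (b * f₁).coeff s = 0 := by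
        rw [AddMonoidAlgebra.coeff_mul]
        refine Finset.sum_eq_zero fun u hu => Finset.sum_eq_zero fun v hv => if_neg fun e => ?_
        have hu' : u ∈ G := hb u (Finsupp.mem_support_iff.1 hu)
        have hv' : v ∈ G :=
          not_not.1 fun h => (Finsupp.mem_support_iff.1 hv) (Finsupp.filter_apply_neg _ _ h)
        exact hs (e ▸ add_mem hu' hv')
      rw [← hsum, AddMonoidAlgebra.coeff_add, Finsupp.add_apply, h1, zero_add] at ha'
      exact ha'
  have hf₂ := (mul_eq_zero.1 h0).resolve_left hb0
  by_contra htG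
  have h2 : f₂.coeff t = f.coeff t := Finsupp.filter_apply_pos _ _ htG
  rw [hf₂] at h2
  exact ht h2.symm

/-- The homogeneous part of degree `N • t` of an equation of integral dependence, of degree `N`, of
a monomial `c x^t`. -/
theorem exists_coeff_equation {A K : Type} [CommRing A] [CommRing K] [Algebra A K] {m : ℕ}
    {R : Subalgebra A (Laurent K m)} {t : Fin m → ℤ} {c : K}
    (h : IsIntegral R (AddMonoidAlgebra.single t c : Laurent K m)) :
    ∃ (N : ℕ) (a : ℕ → R), c ^ N =
      -∑ i ∈ Finset.range N, (a i : Laurent K m).coeff ((N - i) • t) * c ^ i := by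
  obtain ⟨P, hP, h0⟩ := h
  refine ⟨P.natDegree, P.coeff, eq_neg_of_add_eq_zero_right ?_⟩
  rw [Polynomial.eval₂_eq_sum_range, Finset.sum_range_succ, hP.coeff_natDegree, map_one, one_mul]
    at h0
  have h1 := congrArg (fun f => AddMonoidAlgebra.coeff f (P.natDegree • t)) h0
  simp only [AddMonoidAlgebra.single_pow, AddMonoidAlgebra.coeff_add, Finsupp.add_apply,
    AddMonoidAlgebra.coeff_single, Finsupp.single_eq_same, AddMonoidAlgebra.coeff_sum,
    Finsupp.finsetSum_apply, AddMonoidAlgebra.coeff_mul_single_apply] at h1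
  refine Eq.trans ?_ h1
  congr 1
  refine Finset.sum_congr rfl fun i hi => ?_
  rw [sub_nsmul _ (Finset.mem_range.1 hi).le, ← sub_eq_add_neg]
  rfl

/-- In the equation of `exists_coeff_equation`, some coefficient is nonzero; its degree is a multiple
of `t` in `M`. -/
theorem exists_nsmul_mem_of_isIntegral {A : Type} [CommRing A] [IsDomain A] {m : ℕ}
    {M : AddSubmonoid (Fin m → ℤ)} {t : Fin m → ℤ} {c : A} (hc : c ≠ 0)
    (h : IsIntegral (semigroupRing A M) (AddMonoidAlgebra.single t c : Laurent A m)) :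
    ∃ k : ℕ, 0 < k ∧ k • t ∈ M := by
  obtain ⟨N, a, e⟩ := exists_coeff_equation h
  by_contra! hM
  refine pow_ne_zero N hc ?_
  rw [e, Finset.sum_eq_zero, neg_zero]
  intro i hi
  rw [not_not.1 (mt (mem_semigroupRing_iff.1 (a i).2 _)
    (hM (N - i) (Nat.sub_pos_of_lt (Finset.mem_range.1 hi)))), zero_mul]

/-- In the equation of `exists_coeff_equation`, some term has `p`-adic valuation at most that of
`c ^ N`. Its coefficient provides a multiple of `(v_p(c), g)` in `M`, up to adding multiples
of `e_0`. -/
theorem exists_nsmul_mem_of_isIntegral_pSemigroupRing {p : ℕ} [hp : Fact p.Prime] {n : ℕ}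
    {M : AddSubmonoid (Fin (n + 1) → ℤ)} (he : e0 n ∈ M) {g : Fin n → ℤ} {c : ℚ} (hc : c ≠ 0)
    (h : IsIntegral (pSemigroupRing p M) (AddMonoidAlgebra.single g c : Laurent ℚ n)) :
    ∃ k : ℕ, 0 < k ∧ k • (Fin.cons (padicValRat p c) g : Fin (n + 1) → ℤ) ∈ M := by
  obtain ⟨N, a, e⟩ := exists_coeff_equation h
  by_contra! hM
  have hp1 : (1 : ℚ) < p := by exact_mod_cast hp.out.one_lt
  -- Otherwise every term on the right is `p`-adically smaller than `c ^ N`.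
  have hlt : padicNorm p (c ^ N) < padicNorm p (c ^ N) := by
    conv_lhs => rw [e, padicNorm.neg]
    refine padicNorm.sum_lt' (fun i hi => ?_)
      (lt_of_le_of_ne (padicNorm.nonneg _) (padicNorm.nonzero (pow_ne_zero N hc)).symm)
    have hiN := Finset.mem_range.1 hi
    set b := (a i : Laurent ℚ n).coeff ((N - i) • g) with hb
    by_cases hb0 : b = 0
    · rw [hb0, zero_mul, padicNorm.zero]
      exact lt_of_le_of_ne (padicNorm.nonneg _) (padicNorm.nonzero (pow_ne_zero N hc)).symm
    have hmem := (mem_pSemigroupRing_iff he).1 (a i).2 _ hb0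
    have hnot := hM (N - i) (Nat.sub_pos_of_lt hiN)
    have hcons : (N - i) • (Fin.cons (padicValRat p c) g : Fin (n + 1) → ℤ)
        = Fin.cons ((N - i : ℕ) * padicValRat p c) ((N - i) • g) := by
      ext l
      refine Fin.cases ?_ (fun l => ?_) l <;> simp
    rw [hcons] at hnot
    have hval : ((N - i : ℕ) : ℤ) * padicValRat p c < padicValRat p b :=
      not_le.1 fun hle => hnot (cons_mem_of_le he hle hmem)
    rw [padicNorm.eq_zpow_of_nonzero (mul_ne_zero hb0 (pow_ne_zero i hc)),
      padicNorm.eq_zpow_of_nonzero (pow_ne_zero N hc)]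
    refine zpow_lt_zpow_right₀ hp1 (neg_lt_neg ?_)
    rw [padicValRat.mul hb0 (pow_ne_zero i hc), padicValRat.pow, padicValRat.pow]
    push_cast [hiN.le] at hval
    linarith
  exact lt_irrefl _ hlt

/-! ### Normalizations of semigroup rings -/

/-- The normalization of `A[M]` is the semigroup ring of the saturation of `M`. -/
theorem range_eq_semigroupRing_saturation {A : Type} [CommRing A] [IsDomain A] {m : ℕ}
    {M : AddSubmonoid (Fin m → ℤ)}
    (j : Normalization (semigroupRing A M) →ₐ[semigroupRing A M] Laurent A m)
    (hj : ∀ f, f ∈ j.range ↔ IsIntegral (semigroupRing A M) f ∧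
      ∃ a ∈ semigroupRing A M, ∃ b ∈ semigroupRing A M, b ≠ 0 ∧ b * f = a) :
    j.range.restrictScalars A = semigroupRing A (saturation M) := by
  refine le_antisymm (fun f hf => ?_) (Algebra.adjoin_le ?_)
  · obtain ⟨hint, a, ha, b, hb, hb0, e⟩ := (hj f).1 hf
    refine mem_semigroupRing_iff.2 fun t ht => ⟨?_, ?_⟩
    · exact mem_of_mul_eq (AddSubgroup.closure (M : Set (Fin m → ℤ)))
        (fun s hs => AddSubgroup.subset_closure (mem_semigroupRing_iff.1 ha s hs))
        (fun s hs => AddSubgroup.subset_closure (mem_semigroupRing_iff.1 hb s hs)) hb0 e ht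
    · refine exists_nsmul_mem_of_isIntegral ht (isIntegral_homogeneousComponent _ ?_ hint t)
      intro f hf s
      refine mem_semigroupRing_iff.2 fun u hu => ?_
      rw [AddMonoidAlgebra.coeff_single] at hu
      obtain rfl : s = u := not_not.1 fun h => hu (Finsupp.single_eq_of_ne' h)
      exact mem_semigroupRing_iff.1 hf s (by simpa using hu)
  · rintro _ ⟨t, ⟨ht, k, hk, hkt⟩, rfl⟩
    refine (hj _).2 ⟨IsIntegral.of_pow hk ?_, ?_⟩
    · rw [AddMonoidAlgebra.single_pow, one_pow]
      exact isIntegral_algebraMap (x := (⟨_, Algebra.subset_adjoin (Set.mem_image_of_mem _ hkt)⟩ :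
        semigroupRing A M))
    · obtain ⟨u, hu, v, hv, e⟩ := exists_add_eq_of_mem_closure ht
      refine ⟨_, Algebra.subset_adjoin (Set.mem_image_of_mem _ hu), _,
        Algebra.subset_adjoin (Set.mem_image_of_mem _ hv), (isUnit_single_one v).ne_zero, ?_⟩
      rw [AddMonoidAlgebra.single_mul_single, e, one_mul]

/-- The normalization of `ℤ_(p)[M̄]` is the `p`-semigroup ring of the saturation of `M`. -/
theorem range_eq_pSemigroupRing_saturation {p : ℕ} [hp : Fact p.Prime] {n : ℕ}
    {M : AddSubmonoid (Fin (n + 1) → ℤ)} (he : e0 n ∈ M)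
    (j : Normalization (pSemigroupRing p M) →ₐ[pSemigroupRing p M] Laurent ℚ n)
    (hj : ∀ f, f ∈ j.range ↔ IsIntegral (pSemigroupRing p M) f ∧
      ∃ a ∈ pSemigroupRing p M, ∃ b ∈ pSemigroupRing p M, b ≠ 0 ∧ b * f = a) :
    j.range.restrictScalars (ZLoc p) = pSemigroupRing p (saturation M) := by
  refine le_antisymm (fun f hf => ?_) (Algebra.adjoin_le ?_)
  · obtain ⟨hint, a, ha, b, hb, hb0, e⟩ := (hj f).1 hf
    set G := AddSubgroup.closure (M : Set (Fin (n + 1) → ℤ))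
    refine (mem_pSemigroupRing_iff (le_saturation M he)).2 fun g hg => ⟨?_, ?_⟩
    · -- As `e_0` lies in `G`, membership in `G` does not depend on the exponent of `p`.
      let tailHom : (Fin (n + 1) → ℤ) →+ (Fin n → ℤ) :=
        { toFun := Fin.tail, map_zero' := rfl, map_add' := fun _ _ => rfl }
      have key {r : Laurent ℚ n} (hr : r ∈ pSemigroupRing p M) (s : Fin n → ℤ)
          (hs : r.coeff s ≠ 0) : s ∈ G.map tailHom :=
        ⟨_, AddSubgroup.subset_closure ((mem_pSemigroupRing_iff he).1 hr s hs),
          Fin.tail_cons (α := fun _ => ℤ) (padicValRat p (r.coeff s)) s⟩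
      obtain ⟨t, ht, htg⟩ := mem_of_mul_eq (G.map tailHom) (key ha) (key hb) hb0 e hg
      have heG : e0 n ∈ G := AddSubgroup.subset_closure he
      convert add_mem ht (zsmul_mem heG (padicValRat p (f.coeff g) - t 0))
      rw [← htg]
      ext l
      refine Fin.cases ?_ (fun l => ?_) l
      · simp [e0]
      · simp [e0]
        rfl
    · refine exists_nsmul_mem_of_isIntegral_pSemigroupRing he hg
        (isIntegral_homogeneousComponent _ ?_ hint g)
      intro f hf s
      refine (mem_pSemigroupRing_iff he).2 fun u hu => ?_
      rw [AddMonoidAlgebra.coeff_single] at hu ⊢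
      obtain rfl : s = u := not_not.1 fun h => hu (Finsupp.single_eq_of_ne' h)
      rw [Finsupp.single_eq_same] at hu ⊢
      exact (mem_pSemigroupRing_iff he).1 hf s hu
  · rintro _ ⟨t, ⟨ht, k, hk, hkt⟩, rfl⟩
    refine (hj _).2 ⟨IsIntegral.of_pow hk ?_, ?_⟩
    · rw [← pMonomial_nsmul]
      exact isIntegral_algebraMap (x := (⟨_, Algebra.subset_adjoin (Set.mem_image_of_mem _ hkt)⟩ :
        pSemigroupRing p M))
    · obtain ⟨u, hu, v, hv, e⟩ := exists_add_eq_of_mem_closure ht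
      refine ⟨_, Algebra.subset_adjoin (Set.mem_image_of_mem _ hu), _,
        Algebra.subset_adjoin (Set.mem_image_of_mem _ hv), pMonomial_ne_zero p v, ?_⟩
      rw [← pMonomial_add, e]

/-! ### Evaluation at `x_0 = p` -/

theorem evalP_single (p : ℕ) [Fact p.Prime] (n : ℕ) (t : Fin (n + 1) → ℤ) (c : ZLoc p) :
    evalP p n (AddMonoidAlgebra.single t c) = c • pMonomial p t := by
  rw [evalP, AddMonoidAlgebra.lift_single]
  rfl

theorem map_evalP_semigroupRing (p : ℕ) [Fact p.Prime] {n : ℕ}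
    (M : AddSubmonoid (Fin (n + 1) → ℤ)) :
    (semigroupRing (ZLoc p) M).map (evalP p n) = pSemigroupRing p M := by
  rw [semigroupRing, AlgHom.map_adjoin, Set.image_image, pSemigroupRing]
  simp only [evalP_single, one_smul]

theorem coeff_evalP (p : ℕ) [Fact p.Prime] (n : ℕ) (f : Laurent (ZLoc p) (n + 1))
    (g : Fin n → ℤ) : (evalP p n f).coeff g =
      ∑ s ∈ f.coeff.support with Fin.tail s = g, (f.coeff s : ℚ) * (p : ℚ) ^ s 0 := by
  classical
  conv_lhs => rw [← AddMonoidAlgebra.sum_coeff_single f, Finsupp.sum, map_sum]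
  rw [AddMonoidAlgebra.coeff_sum, Finsupp.finsetSum_apply, Finset.sum_filter]
  refine Finset.sum_congr rfl fun s _ => ?_
  rw [evalP_single, pMonomial, AddMonoidAlgebra.smul_single, AddMonoidAlgebra.coeff_single,
    Finsupp.single_apply]
  rfl

/-- The kernel of the evaluation at `x_0 = p` on `ℤ_(p)[N]` is generated by `x_0 - p`: modulo
`x_0 - p`, all terms with the same exponents of `x_1, …, x_n` can be collected at the
smallest occurring exponent of `x_0`. -/
theorem exists_eq_mul_of_evalP_eq_zero {p : ℕ} [hp : Fact p.Prime] {n : ℕ}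
    {N : AddSubmonoid (Fin (n + 1) → ℤ)} (he : e0 n ∈ N) {f : Laurent (ZLoc p) (n + 1)}
    (hf : f ∈ semigroupRing (ZLoc p) N) (h0 : evalP p n f = 0) :
    ∃ h ∈ semigroupRing (ZLoc p) N,
      f = (AddMonoidAlgebra.single (e0 n) 1 - (p : Laurent (ZLoc p) (n + 1))) * h := by
  classical
  have hp0 : (p : ℚ) ≠ 0 := by exact_mod_cast hp.out.ne_zero
  let I : Submodule (ZLoc p) (Laurent (ZLoc p) (n + 1)) :=
    (Subalgebra.toSubmodule (semigroupRing (ZLoc p) N)).map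
      (LinearMap.mulLeft (ZLoc p)
        (AddMonoidAlgebra.single (e0 n) 1 - (p : Laurent (ZLoc p) (n + 1))))
  suffices hI : f ∈ I by
    obtain ⟨h, hh, e⟩ := hI
    exact ⟨h, hh, e.symm⟩
  -- Modulo `x_0 - p`, multiplication by `x_0 ^ k` is multiplication by `p ^ k`.
  have hshift (t : Fin (n + 1) → ℤ) (ht : t ∈ N) (k : ℕ) :
      AddMonoidAlgebra.single (t + k • e0 n) 1
        - (p : ZLoc p) ^ k • AddMonoidAlgebra.single t 1 ∈ I := by
    let X : semigroupRing (ZLoc p) N := x0 (ZLoc p) he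
    obtain ⟨q, hq⟩ := sub_dvd_pow_sub_pow X (p : semigroupRing (ZLoc p) N) k
    have hq' := congrArg Subtype.val hq
    refine ⟨(q : Laurent (ZLoc p) (n + 1)) * AddMonoidAlgebra.single t 1,
      (semigroupRing (ZLoc p) N).mul_mem q.2 (Algebra.subset_adjoin (Set.mem_image_of_mem _ ht)), ?_⟩
    have hX : (X : Laurent (ZLoc p) (n + 1)) = AddMonoidAlgebra.single (e0 n) 1 := rfl
    push_cast [hX] at hq'
    rw [LinearMap.mulLeft_apply, ← mul_assoc, ← hq', sub_mul, AddMonoidAlgebra.single_pow, one_pow,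
      AddMonoidAlgebra.single_mul_single, one_mul, add_comm t,
      ← map_natCast (algebraMap (ZLoc p) (Laurent (ZLoc p) (n + 1))), ← map_pow, ← Algebra.smul_def]
  have hmin (g : Fin n → ℤ) : ∃ a : ℤ, ∀ s ∈ f.coeff.support, Fin.tail s = g →
      a ≤ s 0 ∧ (Fin.cons a g : Fin (n + 1) → ℤ) ∈ N := by
    by_cases hne : (f.coeff.support.filter (Fin.tail · = g)).Nonempty
    · obtain ⟨s, hs, hmin⟩ := Finset.exists_min_image _ (· 0) hne
      obtain ⟨hs1, rfl⟩ := Finset.mem_filter.1 hs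
      refine ⟨s 0, fun u hu hus => ⟨hmin u (Finset.mem_filter.2 ⟨hu, hus⟩), ?_⟩⟩
      rw [Fin.cons_self_tail]
      exact mem_semigroupRing_iff.1 hf s (Finsupp.mem_support_iff.1 hs1)
    · exact ⟨0, fun s hs hsg => absurd ⟨s, Finset.mem_filter.2 ⟨hs, hsg⟩⟩ hne⟩
  choose a ha using hmin
  let base (g : Fin n → ℤ) : Laurent (ZLoc p) (n + 1) :=
    AddMonoidAlgebra.single (Fin.cons (a g) g : Fin (n + 1) → ℤ) 1
  let w (s : Fin (n + 1) → ℤ) : ZLoc p := f.coeff s * (p : ZLoc p) ^ (s 0 - a (Fin.tail s)).toNat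
  -- The terms over `g`, collected at `base g`, have as total coefficient `p ^ (-a g)` times the
  -- coefficient of `x^g` in `evalP p n f`.
  have hzero : ∑ s ∈ f.coeff.support, w s • base (Fin.tail s) = 0 := by
    rw [← Finset.sum_fiberwise_of_maps_to (g := Fin.tail) (t := f.coeff.support.image Fin.tail)
      fun s hs => Finset.mem_image_of_mem _ hs]
    refine Finset.sum_eq_zero fun g _ => ?_
    have hw : ∑ s ∈ f.coeff.support with Fin.tail s = g, w s = 0 := by
      have hc := coeff_evalP p n f g
      rw [h0, AddMonoidAlgebra.coeff_zero, Finsupp.zero_apply] at hc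
      refine Subtype.ext (mul_right_cancel₀ (zpow_ne_zero (a g) hp0) ?_)
      push_cast
      rw [zero_mul, hc, Finset.sum_mul]
      refine Finset.sum_congr rfl fun s hs => ?_
      obtain ⟨hs1, rfl⟩ := Finset.mem_filter.1 hs
      have hle := (ha _ s hs1 rfl).1
      simp only [w]
      push_cast
      rw [mul_assoc, ← zpow_natCast, Int.toNat_of_nonneg (by omega), ← zpow_add₀ hp0,
        sub_add_cancel]
    rw [← zero_smul (ZLoc p) (base g), ← hw, Finset.sum_smul]
    refine Finset.sum_congr rfl fun s hs => ?_
    rw [(Finset.mem_filter.1 hs).2]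
  rw [← sub_zero f, ← hzero]
  conv => enter [2, 1]; rw [← AddMonoidAlgebra.sum_coeff_single f, Finsupp.sum]
  rw [← Finset.sum_sub_distrib]
  refine sum_mem fun s hs => ?_
  obtain ⟨hle, hmem⟩ := ha _ s hs rfl
  have := I.smul_mem (f.coeff s) (hshift _ hmem (s 0 - a (Fin.tail s)).toNat)
  rw [cons_add_nsmul_e0, Int.toNat_of_nonneg (by omega), add_sub_cancel, Fin.cons_self_tail,
    smul_sub, AddMonoidAlgebra.smul_single, smul_eq_mul, mul_one, smul_smul] at this
  exact this

/-- A ring homomorphism whose values lie in the range of an injective homomorphism factors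
through it. -/
theorem exists_ringHom_lift {S R T : Type} [CommRing S] [CommRing R] [CommRing T] {f : S →+* T}
    (j : R →+* T) (hj : Injective j) (hf : ∀ z, ∃ y, j y = f z) :
    ∃ ψ : S →+* R, ∀ z, j (ψ z) = f z := by
  choose d hd using hf
  exact ⟨{ toFun := d
           map_one' := hj (by simp [hd])
           map_mul' := fun _ _ => hj (by simp [hd])
           map_zero' := hj (by simp [hd])
           map_add' := fun _ _ => hj (by simp [hd]) }, hd⟩

set_option maxHeartbeats 1000000 in
/-- Once the normalizations of `S = ℤ_(p)[M]` and `R = ℤ_(p)[M̄]` are identified with their images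
in the Laurent polynomial rings, evaluation at `x_0 = p` maps the former onto the latter with
kernel generated by `x_0 - p`. -/
theorem exists_surjective_normalization_evalP {p : ℕ} [Fact p.Prime] {n : ℕ}
    {M : AddSubmonoid (Fin (n + 1) → ℤ)} (he : e0 n ∈ M)
    {i : Normalization (semigroupRing (ZLoc p) M) →ₐ[semigroupRing (ZLoc p) M]
      Laurent (ZLoc p) (n + 1)}
    {j : Normalization (pSemigroupRing p M) →ₐ[pSemigroupRing p M] Laurent ℚ n}
    (hi : Injective i) (hj : Injective j)
    (hi_mem : ∀ f, f ∈ i.range ↔ f ∈ semigroupRing (ZLoc p) (saturation M))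
    (hj_mem : ∀ f, f ∈ j.range ↔ f ∈ pSemigroupRing p (saturation M)) :
    ∃ ψ : Normalization (semigroupRing (ZLoc p) M) →+* Normalization (pSemigroupRing p M),
      (∀ z, j (ψ z) = evalP p n (i z)) ∧ Surjective ψ ∧
      RingHom.ker ψ = Ideal.span {algebraMap (semigroupRing (ZLoc p) M)
        (Normalization (semigroupRing (ZLoc p) M)) (x0 (ZLoc p) he - (p : _))} := by
  have hmem (z) : evalP p n (i z) ∈ j.range := by
    rw [hj_mem, ← map_evalP_semigroupRing]
    exact ⟨i z, (hi_mem _).1 ⟨z, rfl⟩, rfl⟩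
  obtain ⟨ψ, hψ⟩ := exists_ringHom_lift (f := (evalP p n).toRingHom.comp i.toRingHom)
    j.toRingHom hj hmem
  replace hψ (z) : j (ψ z) = evalP p n (i z) := hψ z
  have hgen : i (algebraMap _ _ (x0 (ZLoc p) he - (p : semigroupRing (ZLoc p) M)))
      = AddMonoidAlgebra.single (e0 n) 1 - (p : Laurent (ZLoc p) (n + 1)) := by
    rw [i.commutes, map_sub, map_natCast]
    rfl
  refine ⟨ψ, hψ, fun y => ?_, le_antisymm (fun z hz => ?_) ?_⟩
  · have hy := (hj_mem _).1 ⟨y, rfl⟩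
    rw [← map_evalP_semigroupRing] at hy
    obtain ⟨f, hf, e⟩ := hy
    obtain ⟨z, rfl⟩ := (hi_mem f).2 hf
    exact ⟨z, hj ((hψ z).trans e)⟩
  · have h0 : evalP p n (i z) = 0 := by
      rw [← hψ, (RingHom.mem_ker).1 hz, map_zero]
    obtain ⟨h, hh, e⟩ := exists_eq_mul_of_evalP_eq_zero (le_saturation M he)
      ((hi_mem _).1 ⟨z, rfl⟩) h0
    obtain ⟨w, rfl⟩ := (hi_mem h).2 hh
    refine Ideal.mem_span_singleton.2 ⟨w, hi ?_⟩
    rw [map_mul, hgen]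
    exact e
  · rw [Ideal.span_singleton_le_iff_mem, RingHom.mem_ker]
    refine hj ?_
    rw [hψ, hgen, map_sub, map_natCast, evalP_single, one_smul, map_zero, sub_eq_zero]
    simp [pMonomial, e0]
    rfl

set_option maxHeartbeats 1000000 in
theorem mainTheorem10 (p : ℕ) [Fact p.Prime] (n : ℕ) :
    -- the normalization of a pointed affine `p`-semigroup ring embeds over `R` in the ambient
    -- Laurent polynomial ring, and it is there a pointed affine `p`-semigroup ring
    (∀ R : Subalgebra (ZLoc p) (Laurent ℚ n), IsPointedAffinePSemigroupRing p R →
      ∃ j : Normalization R →ₐ[R] Laurent ℚ n,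
        Injective j ∧ IsPointedAffinePSemigroupRing p (j.range.restrictScalars (ZLoc p))) ∧
    -- evaluation at `x_0 = p` induces a surjection of normalizations, with kernel `(x_0 - p)`
    (∀ (M : AddSubmonoid (Fin (n + 1) → ℤ)) (he : e0 n ∈ M), M.FG → IsPointedSemigroup M →
      ∃ (i : Normalization (semigroupRing (ZLoc p) M) →ₐ[semigroupRing (ZLoc p) M]
            Laurent (ZLoc p) (n + 1))
        (j : Normalization (pSemigroupRing p M) →ₐ[pSemigroupRing p M] Laurent ℚ n)
        (ψ : Normalization (semigroupRing (ZLoc p) M) →+*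
            Normalization (pSemigroupRing p M)),
        Injective i ∧ Injective j ∧
        (∀ z, j (ψ z) = evalP p n (i z)) ∧
        Surjective ψ ∧
        RingHom.ker ψ =
          Ideal.span {algebraMap (semigroupRing (ZLoc p) M)
            (Normalization (semigroupRing (ZLoc p) M)) (x0 (ZLoc p) he - (p : _))}) := by
  refine ⟨?_, fun M he _ _ => ?_⟩
  · rintro _ ⟨M, he, hfg, hpt, rfl⟩
    obtain ⟨j, hinj, hj⟩ := exists_normalization_embedding (pSemigroupRing p M)
    exact ⟨j, hinj, saturation M, le_saturation M he, saturation_fg hfg,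
      isPointedSemigroup_saturation hpt, range_eq_pSemigroupRing_saturation he j hj⟩
  obtain ⟨i, hi, hi'⟩ := exists_normalization_embedding (semigroupRing (ZLoc p) M)
  refine ⟨i, ?_⟩
  obtain ⟨j, hj, hj'⟩ := exists_normalization_embedding (pSemigroupRing p M)
  refine ⟨j, ?_⟩
  obtain ⟨ψ, h⟩ := exists_surjective_normalization_evalP he hi hj
    (SetLike.ext_iff.1 (range_eq_semigroupRing_saturation i hi'))
    (SetLike.ext_iff.1 (range_eq_pSemigroupRing_saturation he j hj'))
  exact ⟨ψ, hi, hj, h⟩
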